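/- Let $k$ be an algebraically closed field (of arbitrary characteristic) and let $H$ be a finite-dimensional Hopf algebra over $k$, with comultiplication $\Delta(h)=h_{(1)}\otimes h_{(2)}$, counit $\varepsilon$ and antipode $S$. Assume that $H$ is unimodular, i.e. the left integrals in $H$ (the elements $\Lambda$ with $h\Lambda=\varepsilon(h)\Lambda$ for all $h\in H$) coincide with the right integrals in $H$ (the elements $\Lambda$ with $\Lambda h=\varepsilon(h)\Lambda$ for all $h\in H$). Let $J$ be a (normalized) twist for $H$, i.e. an invertible element $J\in H\otimes H$ with $$(\Delta\otimes\mathrm{id})(J)(J\otimes 1)=(\mathrm{id}\otimes\Delta)(J)(1\otimes J),\qquad (\varepsilon\otimes\mathrm{id})(J)=(\mathrm{id}\otimes\varepsilon)(J)=1 .$$ Write $J=J^{(1)}\otimes J^{(2)}$ and $J^{-1}=J^{-(1)}\otimes J^{-(2)}$ (summation understood), let $Q_J=S(J^{(1)})J^{(2)}$, an invertible element of $H$ with inverse $Q_J^{-1}=J^{-(1)}S(J^{-(2)})$, and let $u_J=Q_J^{-1}S(Q_J)$. Let $H^J$ be the twisted Hopf algebra: it has the same algebra structure and counit as $H$, comultiplication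 $\Delta^J(h)=J^{-1}\Delta(h)J$ and antipode $S^J(h)=Q_J^{-1}S(h)Q_J$. A left (respectively, right) integral on a Hopf algebra $A$ with comultiplication $a\mapsto a_{(1)}\otimes a_{(2)}$ is a linear functional $\lambda\in A^*$ (respectively, $\rho\in A^*$) such that $a_{(1)}\langle\lambda,a_{(2)}\rangle=\langle\lambda,a\rangle 1$ (respectively, $\langle\rho,a_{(1)}\rangle a_{(2)}=\langle\rho,a\rangle 1$) for all $a\in A$. For $h\in H$ and $\phi\in H^*$ let $h\rightharpoonup\phi$ and $\phi\leftharpoonup h$ be the functionals $\langle h\rightharpoonup\phi,x\rangle=\langle\phi,xh\rangle$ and $\langle\phi\leftharpoonup h,x\rangle=\langle\phi,hx\rangle$, $x\in H$. If $\lambda$ is a non-zero left integral on $H$, then $\lambda_J:=u_J\rightharpoonup\lambda$ is a non-zero left integral on $H^J$; and if $\rho$ is a non-zero right integral on $H$, then $\rho_J:=\rho\leftharpoonup u_J^{-1}$ is a non-zero right integral on $H^J$. -/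

import Mathlib

open scoped TensorProduct
open Coalgebra Bialgebra

noncomputable section

/-- `λ ∈ A^*` is a left integral on `A`: `h₍₁₎ ⟨λ, h₍₂₎⟩ = ⟨λ, h⟩ 1` for all `h`. -/
def IsLeftIntegralOn {k A : Type*} [CommRing k] [Ring A] [Bialgebra k A]
    (lam : Module.Dual k A) : Prop :=
  ∀ h : A, TensorProduct.rid k A (LinearMap.lTensor A lam (comul (R := k) h)) = lam h • (1 : A)

/-- `ρ ∈ A^*` is a right integral on `A`: `⟨ρ, h₍₁₎⟩ h₍₂₎ = ⟨ρ, h⟩ 1` for all `h`. -/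
def IsRightIntegralOn {k A : Type*} [CommRing k] [Ring A] [Bialgebra k A]
    (rho : Module.Dual k A) : Prop :=
  ∀ h : A, TensorProduct.lid k A (LinearMap.rTensor A rho (comul (R := k) h)) = rho h • (1 : A)

/-- `A` is unimodular: the left integrals in `A` (the `Λ` with `h Λ = ε(h) Λ` for all `h`)
and the right integrals in `A` (the `Λ` with `Λ h = ε(h) Λ` for all `h`) coincide. -/
def IsUnimodular (k A : Type*) [CommRing k] [Ring A] [Bialgebra k A] : Prop :=
  ∀ L : A, (∀ h : A, h * L = counit (R := k) h • L) ↔ (∀ h : A, L * h = counit (R := k) h • L)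

/-- The left action of `A` on `A^*`: `h ⇀ φ = φ₍₁₎ ⟨φ₍₂₎, h⟩`, i.e. `⟨h ⇀ φ, x⟩ = ⟨φ, x h⟩`
(the comultiplication of `A^*` being dual to the multiplication of `A`). -/
def hitLeft {k A : Type*} [CommRing k] [Ring A] [Algebra k A]
    (h : A) (phi : Module.Dual k A) : Module.Dual k A :=
  phi ∘ₗ LinearMap.mulRight k h

/-- The right action of `A` on `A^*`: `φ ↼ h = ⟨φ₍₁₎, h⟩ φ₍₂₎`, i.e. `⟨φ ↼ h, x⟩ = ⟨φ, h x⟩`. -/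
def hitRight {k A : Type*} [CommRing k] [Ring A] [Algebra k A]
    (phi : Module.Dual k A) (h : A) : Module.Dual k A :=
  phi ∘ₗ LinearMap.mulLeft k h

infixr:70 " ⇀ₕ " => hitLeft
infixl:70 " ↼ₕ " => hitRight

/-- A (normalized) twist for `H`: an invertible `J ∈ H ⊗ H` with
`(Δ ⊗ id)(J) (J ⊗ 1) = (id ⊗ Δ)(J) (1 ⊗ J)` and `(ε ⊗ id)(J) = (id ⊗ ε)(J) = 1`. -/
structure HopfTwist (k H : Type*) [CommRing k] [Ring H] [HopfAlgebra k H] where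
  /-- the invertible element `J` -/
  J : (H ⊗[k] H)ˣ
  twist_eq :
    Algebra.TensorProduct.assoc k k k H H H
        (LinearMap.rTensor H (comul (R := k) (A := H)) J.val * (J.val ⊗ₜ[k] (1 : H))) =
      LinearMap.lTensor H (comul (R := k) (A := H)) J.val * ((1 : H) ⊗ₜ[k] J.val)
  counit_left :
    TensorProduct.lid k H (LinearMap.rTensor H (counit (R := k) (A := H)) J.val) = 1
  counit_right :
    TensorProduct.rid k H (LinearMap.lTensor H (counit (R := k) (A := H)) J.val) = 1

namespace HopfTwist

variable {k H : Type*} [CommRing k] [Ring H] [HopfAlgebra k H] (T : HopfTwist k H)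

/-- `a ⊗ b ↦ S(a) b` -/
def mSl (k H : Type*) [CommRing k] [Ring H] [HopfAlgebra k H] : H ⊗[k] H →ₗ[k] H :=
  LinearMap.mul' k H ∘ₗ (HopfAlgebra.antipode k).rTensor H

/-- `a ⊗ b ↦ a S(b)` -/
def mSr (k H : Type*) [CommRing k] [Ring H] [HopfAlgebra k H] : H ⊗[k] H →ₗ[k] H :=
  LinearMap.mul' k H ∘ₗ (HopfAlgebra.antipode k).lTensor H

@[simp] lemma mSl_tmul (a b : H) : mSl k H (a ⊗ₜ b) = HopfAlgebra.antipode k a * b := by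
  simp [mSl]

@[simp] lemma mSr_tmul (a b : H) : mSr k H (a ⊗ₜ b) = a * HopfAlgebra.antipode k b := by
  simp [mSr]

@[simp] lemma mSl_comul (a : H) : mSl k H (comul (R := k) a) = algebraMap k H (counit a) :=
  HopfAlgebra.mul_antipode_rTensor_comul_apply a

@[simp] lemma mSr_comul (a : H) : mSr k H (comul (R := k) a) = algebraMap k H (counit a) :=
  HopfAlgebra.mul_antipode_lTensor_comul_apply a

/-- `Δ ⊗ id` as an algebra map into `H ⊗ (H ⊗ H)`. -/
def D1 (k H : Type*) [CommRing k] [Ring H] [HopfAlgebra k H] :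
    H ⊗[k] H →ₐ[k] H ⊗[k] (H ⊗[k] H) :=
  (Algebra.TensorProduct.assoc k k k H H H).toAlgHom.comp
    (Algebra.TensorProduct.map (comulAlgHom k H) (AlgHom.id k H))

/-- `id ⊗ Δ` as an algebra map. -/
def D2 (k H : Type*) [CommRing k] [Ring H] [HopfAlgebra k H] :
    H ⊗[k] H →ₐ[k] H ⊗[k] (H ⊗[k] H) :=
  Algebra.TensorProduct.map (AlgHom.id k H) (comulAlgHom k H)

/-- `x ↦ x ⊗ 1` into `H ⊗ (H ⊗ H)`. -/
def E1 (k H : Type*) [CommRing k] [Ring H] [HopfAlgebra k H] :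
    H ⊗[k] H →ₐ[k] H ⊗[k] (H ⊗[k] H) :=
  (Algebra.TensorProduct.assoc k k k H H H).toAlgHom.comp
    Algebra.TensorProduct.includeLeft

/-- `x ↦ 1 ⊗ x` into `H ⊗ (H ⊗ H)`. -/
def E2 (k H : Type*) [CommRing k] [Ring H] [HopfAlgebra k H] :
    H ⊗[k] H →ₐ[k] H ⊗[k] (H ⊗[k] H) :=
  Algebra.TensorProduct.includeRight

/-- `ε ⊗ id` as an algebra map. -/
def eL (k H : Type*) [CommRing k] [Ring H] [HopfAlgebra k H] : H ⊗[k] H →ₐ[k] H :=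
  (Algebra.TensorProduct.lid k H).toAlgHom.comp
    (Algebra.TensorProduct.map (counitAlgHom k H) (AlgHom.id k H))

/-- `id ⊗ ε` as an algebra map. -/
def eR (k H : Type*) [CommRing k] [Ring H] [HopfAlgebra k H] : H ⊗[k] H →ₐ[k] H :=
  (Algebra.TensorProduct.rid k k H).toAlgHom.comp
    (Algebra.TensorProduct.map (AlgHom.id k H) (counitAlgHom k H))

lemma D1_apply (x : H ⊗[k] H) :
    D1 k H x = TensorProduct.assoc k H H H (LinearMap.rTensor H (comul (R := k)) x) := by
  induction x with
  | zero => simp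
  | add x y hx hy => simp [hx, hy]
  | tmul a b => rfl

lemma D2_apply (x : H ⊗[k] H) : D2 k H x = LinearMap.lTensor H (comul (R := k)) x := by
  induction x with
  | zero => simp
  | add x y hx hy => simp [hx, hy]
  | tmul a b => rfl

lemma eL_apply (x : H ⊗[k] H) :
    eL k H x = TensorProduct.lid k H (LinearMap.rTensor H (counit (R := k)) x) := by
  induction x with
  | zero => simp
  | add x y hx hy => simp [hx, hy]
  | tmul a b => rfl

lemma eR_apply (x : H ⊗[k] H) :
    eR k H x = TensorProduct.rid k H (LinearMap.lTensor H (counit (R := k)) x) := by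
  induction x with
  | zero => simp
  | add x y hx hy => simp [hx, hy]
  | tmul a b => rfl

lemma eL_J : eL k H T.J.val = 1 := (eL_apply _).trans T.counit_left

lemma eR_J : eR k H T.J.val = 1 := (eR_apply _).trans T.counit_right

lemma eL_Jinv : eL k H (T.J⁻¹).val = 1 := by
  have h : eL k H T.J.val * eL k H (T.J⁻¹).val = 1 := by
    rw [← map_mul, Units.mul_inv, map_one]
  rwa [eL_J, one_mul] at h

lemma eR_Jinv : eR k H (T.J⁻¹).val = 1 := by
  have h : eR k H T.J.val * eR k H (T.J⁻¹).val = 1 := by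
    rw [← map_mul, Units.mul_inv, map_one]
  rwa [eR_J, one_mul] at h

lemma twist_eq' :
    D1 k H T.J.val * E1 k H T.J.val = D2 k H T.J.val * E2 k H T.J.val := by
  have h := T.twist_eq
  rw [map_mul] at h
  rw [D1_apply, D2_apply]
  exact h

lemma D1_mul_inv : D1 k H T.J.val * D1 k H (T.J⁻¹).val = 1 := by
  rw [← map_mul, Units.mul_inv, map_one]

lemma D1_inv_mul : D1 k H (T.J⁻¹).val * D1 k H T.J.val = 1 := by
  rw [← map_mul, Units.inv_mul, map_one]

lemma D2_mul_inv : D2 k H T.J.val * D2 k H (T.J⁻¹).val = 1 := by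
  rw [← map_mul, Units.mul_inv, map_one]

lemma D2_inv_mul : D2 k H (T.J⁻¹).val * D2 k H T.J.val = 1 := by
  rw [← map_mul, Units.inv_mul, map_one]

lemma E1_mul_inv : E1 k H T.J.val * E1 k H (T.J⁻¹).val = 1 := by
  rw [← map_mul, Units.mul_inv, map_one]

lemma E1_inv_mul : E1 k H (T.J⁻¹).val * E1 k H T.J.val = 1 := by
  rw [← map_mul, Units.inv_mul, map_one]

lemma E2_mul_inv : E2 k H T.J.val * E2 k H (T.J⁻¹).val = 1 := by
  rw [← map_mul, Units.mul_inv, map_one]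

lemma E2_inv_mul : E2 k H (T.J⁻¹).val * E2 k H T.J.val = 1 := by
  rw [← map_mul, Units.inv_mul, map_one]

lemma twist_eq_inv :
    E1 k H (T.J⁻¹).val * D1 k H (T.J⁻¹).val = E2 k H (T.J⁻¹).val * D2 k H (T.J⁻¹).val := by
  have h1 : (E1 k H (T.J⁻¹).val * D1 k H (T.J⁻¹).val) *
      (D1 k H T.J.val * E1 k H T.J.val) = 1 := by
    rw [mul_assoc, ← mul_assoc (D1 k H _), D1_inv_mul, one_mul, E1_inv_mul]
  have h2 : (D2 k H T.J.val * E2 k H T.J.val) *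
      (E2 k H (T.J⁻¹).val * D2 k H (T.J⁻¹).val) = 1 := by
    rw [mul_assoc, ← mul_assoc (E2 k H _), E2_mul_inv, one_mul, D2_mul_inv]
  rw [← twist_eq'] at h2
  exact left_inv_eq_right_inv h1 h2

/-- `a ⊗ b ⊗ c ↦ S(a) b S(c)` -/
def M1 (k H : Type*) [CommRing k] [Ring H] [HopfAlgebra k H] :
    H ⊗[k] (H ⊗[k] H) →ₗ[k] H :=
  LinearMap.mul' k H ∘ₗ TensorProduct.map (HopfAlgebra.antipode k) (mSr k H)

/-- `a ⊗ b ⊗ c ↦ a S(b) c` -/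
def M2 (k H : Type*) [CommRing k] [Ring H] [HopfAlgebra k H] :
    H ⊗[k] (H ⊗[k] H) →ₗ[k] H :=
  LinearMap.mul' k H ∘ₗ TensorProduct.map LinearMap.id (mSl k H)

lemma M1_E (x y : H ⊗[k] H) : M1 k H (E1 k H x * E2 k H y) = mSl k H x * mSr k H y := by
  induction x with
  | zero => simp
  | add x x' hx hx' => simp [add_mul, hx, hx']
  | tmul a b =>
    induction y with
    | zero => simp
    | add y y' hy hy' => rw [map_add, mul_add, map_add, hy, hy', map_add, mul_add]
    | tmul c d => simp [M1, E1, E2, mul_assoc]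

lemma M2_E (x y : H ⊗[k] H) : M2 k H (E2 k H y * E1 k H x) = mSr k H x * mSl k H y := by
  induction x with
  | zero => simp
  | add x x' hx hx' => simp [add_mul, mul_add, hx, hx']
  | tmul a b =>
    induction y with
    | zero => simp
    | add y y' hy hy' => rw [map_add, add_mul, map_add, hy, hy', map_add, mul_add]
    | tmul c d => simp [M2, E1, E2, mul_assoc, HopfAlgebra.antipode_mul_antidistrib]

lemma M1_aux (t w : H ⊗[k] H) (q r : H) :
    M1 k H (TensorProduct.assoc k H H H (t ⊗ₜ q) * (r ⊗ₜ w)) =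
      HopfAlgebra.antipode k r * mSl k H t * mSr k H w * HopfAlgebra.antipode k q := by
  induction t with
  | zero => simp
  | add x x' hx hx' => simp [TensorProduct.add_tmul, add_mul, mul_add, hx, hx']
  | tmul a b =>
    induction w with
    | zero => simp
    | add y y' hy hy' => simp only [TensorProduct.tmul_add, mul_add, map_add, hy, hy', add_mul]
    | tmul c d => simp [M1, mul_assoc, HopfAlgebra.antipode_mul_antidistrib]

lemma M2_aux (t w : H ⊗[k] H) (q r : H) :
    M2 k H ((r ⊗ₜ w) * TensorProduct.assoc k H H H (t ⊗ₜ q)) =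
      r * mSr k H t * mSl k H w * q := by
  induction t with
  | zero => simp
  | add x x' hx hx' => simp [TensorProduct.add_tmul, add_mul, mul_add, hx, hx']
  | tmul a b =>
    induction w with
    | zero => simp
    | add y y' hy hy' => simp only [TensorProduct.tmul_add, mul_add, map_add, hy, hy', add_mul]
    | tmul c d => simp [M2, mul_assoc, HopfAlgebra.antipode_mul_antidistrib]

lemma M1_D (x y : H ⊗[k] H) :
    M1 k H (D1 k H x * D2 k H y) =
      HopfAlgebra.antipode k (eR k H y) * HopfAlgebra.antipode k (eL k H x) := by
  induction x with
  | zero => simp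
  | add x x' hx hx' => simp [add_mul, mul_add, hx, hx']
  | tmul p q =>
    induction y with
    | zero => simp
    | add y y' hy hy' => rw [map_add, mul_add, map_add, hy, hy', map_add, map_add, add_mul]
    | tmul r s =>
      have h := M1_aux (comul (R := k) p) (comul (R := k) s) q r
      rw [mSl_comul, mSr_comul] at h
      refine Eq.trans ?_ (h.trans ?_)
      · rfl
      · simp [eL, eR, Algebra.algebraMap_eq_smul_one, smul_smul, mul_comm]

lemma M2_D (x y : H ⊗[k] H) :
    M2 k H (D2 k H y * D1 k H x) = eR k H y * eL k H x := by
  induction x with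
  | zero => simp
  | add x x' hx hx' => simp [mul_add, hx, hx']
  | tmul p q =>
    induction y with
    | zero => simp
    | add y y' hy hy' => rw [map_add, add_mul, map_add, hy, hy', map_add, add_mul]
    | tmul r s =>
      have h := M2_aux (comul (R := k) p) (comul (R := k) s) q r
      rw [mSl_comul, mSr_comul] at h
      refine Eq.trans ?_ (h.trans ?_)
      · rfl
      · simp [eL, eR, Algebra.algebraMap_eq_smul_one, smul_smul, mul_comm]

/-- The invertible element `Q_J = S(J⁽¹⁾) J⁽²⁾`, with inverse `Q_J⁻¹ = J⁻⁽¹⁾ S(J⁻⁽²⁾)`,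
where `J = J⁽¹⁾ ⊗ J⁽²⁾` and `J⁻¹ = J⁻⁽¹⁾ ⊗ J⁻⁽²⁾`. -/
def Q : Hˣ where
  val := LinearMap.mul' k H ((HopfAlgebra.antipode k).rTensor H T.J.val)
  inv := LinearMap.mul' k H ((HopfAlgebra.antipode k).lTensor H (T.J⁻¹).val)
  val_inv := by
    change mSl k H T.J.val * mSr k H (T.J⁻¹).val = 1
    have h : E1 k H T.J.val * E2 k H (T.J⁻¹).val =
        D1 k H (T.J⁻¹).val * D2 k H T.J.val := by
      calc E1 k H T.J.val * E2 k H (T.J⁻¹).val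
          = (D1 k H (T.J⁻¹).val * D1 k H T.J.val) * E1 k H T.J.val * E2 k H (T.J⁻¹).val := by
            rw [D1_inv_mul, one_mul]
        _ = D1 k H (T.J⁻¹).val * (D1 k H T.J.val * E1 k H T.J.val) * E2 k H (T.J⁻¹).val := by
            simp only [mul_assoc]
        _ = D1 k H (T.J⁻¹).val * D2 k H T.J.val *
              (E2 k H T.J.val * E2 k H (T.J⁻¹).val) := by
            rw [twist_eq']; simp only [mul_assoc]
        _ = _ := by rw [E2_mul_inv, mul_one]
    rw [← M1_E, h, M1_D, eR_J, eL_Jinv]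
    simp
  inv_val := by
    change mSr k H (T.J⁻¹).val * mSl k H T.J.val = 1
    have h : E2 k H T.J.val * E1 k H (T.J⁻¹).val =
        D2 k H (T.J⁻¹).val * D1 k H T.J.val := by
      calc E2 k H T.J.val * E1 k H (T.J⁻¹).val
          = (D2 k H (T.J⁻¹).val * D2 k H T.J.val) * E2 k H T.J.val * E1 k H (T.J⁻¹).val := by
            rw [D2_inv_mul, one_mul]
        _ = D2 k H (T.J⁻¹).val * (D2 k H T.J.val * E2 k H T.J.val) * E1 k H (T.J⁻¹).val := by
            simp only [mul_assoc]
        _ = D2 k H (T.J⁻¹).val * D1 k H T.J.val *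
              (E1 k H T.J.val * E1 k H (T.J⁻¹).val) := by
            rw [← twist_eq']; simp only [mul_assoc]
        _ = _ := by rw [E1_mul_inv, mul_one]
    rw [← M2_E, h, M2_D, eR_Jinv, eL_J, one_mul]

/-- The invertible element `u_J = Q_J⁻¹ S(Q_J)`. -/
def u : Hˣ where
  val := (T.Q⁻¹).val * HopfAlgebra.antipode k T.Q.val
  inv := HopfAlgebra.antipode k (T.Q⁻¹).val * T.Q.val
  val_inv := by
    rw [mul_assoc, ← mul_assoc (HopfAlgebra.antipode k _), ← HopfAlgebra.antipode_mul_antidistrib]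
    simp
  inv_val := by
    rw [mul_assoc, ← mul_assoc T.Q.val]
    simp [← HopfAlgebra.antipode_mul_antidistrib]

/-- The twisted comultiplication `Δ^J(h) = J⁻¹ Δ(h) J`. -/
def twComul : H →ₗ[k] H ⊗[k] H :=
  LinearMap.mulLeft k (T.J⁻¹).val ∘ₗ LinearMap.mulRight k T.J.val ∘ₗ comul

/-- The twisted antipode `S^J(h) = Q_J⁻¹ S(h) Q_J`. -/
def twAntipode : H →ₗ[k] H :=
  LinearMap.mulLeft k (T.Q⁻¹).val ∘ₗ LinearMap.mulRight k T.Q.val ∘ₗ HopfAlgebra.antipode k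

lemma twComul_apply (h : H) :
    T.twComul h = (T.J⁻¹).val * comul (R := k) h * T.J.val := by
  simp [twComul, mul_assoc]

lemma twAntipode_apply (h : H) :
    T.twAntipode h = (T.Q⁻¹).val * HopfAlgebra.antipode k h * T.Q.val := by
  simp [twAntipode, mul_assoc]

lemma assoc_rTensor_twComul (x : H ⊗[k] H) :
    TensorProduct.assoc k H H H (LinearMap.rTensor H T.twComul x) =
      E1 k H (T.J⁻¹).val * D1 k H x * E1 k H T.J.val := by
  induction x with
  | zero => simp
  | add x y hx hy => simp [hx, hy, mul_add, add_mul]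
  | tmul a b =>
    have : LinearMap.rTensor H T.twComul (a ⊗ₜ b) =
        ((T.J⁻¹).val ⊗ₜ[k] (1 : H)) * (comul (R := k) a ⊗ₜ[k] b) * (T.J.val ⊗ₜ[k] (1 : H)) := by
      simp [twComul_apply]
    rw [this]
    change Algebra.TensorProduct.assoc k k k H H H _ = _
    rw [map_mul, map_mul]
    rfl

lemma lTensor_twComul (x : H ⊗[k] H) :
    LinearMap.lTensor H T.twComul x =
      E2 k H (T.J⁻¹).val * D2 k H x * E2 k H T.J.val := by
  induction x with
  | zero => simp
  | add x y hx hy => simp [hx, hy, mul_add, add_mul]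
  | tmul a b => simp [twComul_apply, E2, D2]

lemma twComul_coassoc (h : H) :
    TensorProduct.assoc k H H H (LinearMap.rTensor H T.twComul (T.twComul h)) =
      LinearMap.lTensor H T.twComul (T.twComul h) := by
  rw [assoc_rTensor_twComul, lTensor_twComul, twComul_apply]
  simp only [map_mul]
  have hc : D1 k H (comul (R := k) h) = D2 k H (comul (R := k) h) := by
    rw [D1_apply, D2_apply]; exact Coalgebra.coassoc_apply h
  have h1 := T.twist_eq_inv
  have h2 := T.twist_eq'
  calc _ = (E1 k H (T.J⁻¹).val * D1 k H (T.J⁻¹).val) * D1 k H (comul (R := k) h) *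
        (D1 k H T.J.val * E1 k H T.J.val) := by simp only [mul_assoc]
    _ = _ := by rw [h1, h2, hc]; simp only [mul_assoc]

/-- `a ⊗ b ↦ S(a) q b` -/
def N (q : H) : H ⊗[k] H →ₗ[k] H :=
  LinearMap.mul' k H ∘ₗ TensorProduct.map (HopfAlgebra.antipode k) (LinearMap.mulLeft k q)

/-- `a ⊗ b ↦ a q S(b)` -/
def P (q : H) : H ⊗[k] H →ₗ[k] H :=
  LinearMap.mul' k H ∘ₗ TensorProduct.map (LinearMap.mulRight k q) (HopfAlgebra.antipode k)

lemma N_mul (q : H) (x y : H ⊗[k] H) : N q (x * y) = N (N q x) y := by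
  induction y with
  | zero => simp
  | add y y' hy hy' => simp only [mul_add, map_add, hy, hy']
  | tmul c d =>
    induction x with
    | zero => simp [N]
    | add x x' hx hx' => rw [add_mul, map_add, map_add, hx, hx']; simp [N, mul_add, add_mul]
    | tmul a b => simp [N, mul_assoc, HopfAlgebra.antipode_mul_antidistrib]

lemma P_mul (q : H) (x y : H ⊗[k] H) : P q (x * y) = P (P q y) x := by
  induction x with
  | zero => simp
  | add y y' hy hy' => simp only [add_mul, map_add, hy, hy']
  | tmul c d =>
    induction y with
    | zero => simp [P]
    | add x x' hx hx' => rw [mul_add, map_add, map_add, hx, hx']; simp [P, mul_add, add_mul]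
    | tmul a b => simp [P, mul_assoc, HopfAlgebra.antipode_mul_antidistrib]

lemma N_smul (r : k) (x : H ⊗[k] H) :
    N (algebraMap k H r) x = algebraMap k H r * mSl k H x := by
  induction x with
  | zero => simp
  | add x y hx hy => simp only [map_add, hx, hy, mul_add]
  | tmul a b => simp [N, Algebra.algebraMap_eq_smul_one]

lemma P_smul (r : k) (x : H ⊗[k] H) :
    P (algebraMap k H r) x = algebraMap k H r * mSr k H x := by
  induction x with
  | zero => simp
  | add x y hx hy => simp only [map_add, hx, hy, mul_add]
  | tmul a b => simp [P, Algebra.algebraMap_eq_smul_one]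

lemma N_one (x : H ⊗[k] H) : N 1 x = mSl k H x := by
  simpa using N_smul (1 : k) x

lemma P_one (x : H ⊗[k] H) : P 1 x = mSr k H x := by
  simpa using P_smul (1 : k) x

lemma mul_rTensor_twAntipode (x : H ⊗[k] H) :
    LinearMap.mul' k H (LinearMap.rTensor H T.twAntipode x) = (T.Q⁻¹).val * N T.Q.val x := by
  induction x with
  | zero => simp
  | add x y hx hy => simp only [map_add, hx, hy, mul_add]
  | tmul a b => simp [N, twAntipode_apply, mul_assoc]

lemma mul_lTensor_twAntipode (x : H ⊗[k] H) :
    LinearMap.mul' k H (LinearMap.lTensor H T.twAntipode x) = P (T.Q⁻¹).val x * T.Q.val := by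
  induction x with
  | zero => simp
  | add x y hx hy => simp only [map_add, hx, hy, add_mul]
  | tmul a b => simp [P, twAntipode_apply, mul_assoc]

lemma Q_val : T.Q.val = mSl k H T.J.val := rfl

lemma Q_inv_val : (T.Q⁻¹).val = mSr k H (T.J⁻¹).val := rfl

lemma twAntipode_left (h : H) :
    LinearMap.mul' k H (LinearMap.rTensor H T.twAntipode (T.twComul h)) =
      algebraMap k H (counit h) := by
  have h1 : N T.Q.val (T.J⁻¹).val = 1 := by
    rw [Q_val, ← N_one, ← N_mul, Units.mul_inv, N_one]
    simp [Algebra.TensorProduct.one_def]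
  rw [mul_rTensor_twAntipode, twComul_apply, N_mul, N_mul, h1, N_one, mSl_comul, N_smul,
    ← Q_val, Algebra.commutes, ← mul_assoc, Units.inv_mul, one_mul]

lemma twAntipode_right (h : H) :
    LinearMap.mul' k H (LinearMap.lTensor H T.twAntipode (T.twComul h)) =
      algebraMap k H (counit h) := by
  have h1 : P (T.Q⁻¹).val T.J.val = 1 := by
    rw [Q_inv_val, ← P_one, ← P_mul, Units.mul_inv, P_one]
    simp [Algebra.TensorProduct.one_def]
  rw [mul_lTensor_twAntipode, twComul_apply, mul_assoc, P_mul, P_mul, h1, P_one, mSr_comul,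
    P_smul, ← Q_inv_val, mul_assoc, Units.inv_mul, mul_one]

lemma twComul_counit_left (h : H) :
    LinearMap.rTensor H (counit (R := k)) (T.twComul h) = 1 ⊗ₜ h := by
  apply (TensorProduct.lid k H).injective
  rw [← eL_apply, twComul_apply, map_mul, map_mul, eL_J, eL_Jinv, eL_apply]
  simp

lemma twComul_counit_right (h : H) :
    LinearMap.lTensor H (counit (R := k)) (T.twComul h) = h ⊗ₜ 1 := by
  apply (TensorProduct.rid k H).injective
  rw [← eR_apply, twComul_apply, map_mul, map_mul, eR_J, eR_Jinv, eR_apply]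
  simp

/-- The Hopf algebra structure of `H^J`, on the same underlying algebra `H` and with the same
counit, with comultiplication `J⁻¹ Δ(h) J` and antipode `Q_J⁻¹ S(h) Q_J`. -/
@[reducible]
def hopfAlgebra : HopfAlgebra k H where
  toAlgebra := inferInstance
  comul := T.twComul
  counit := counit
  coassoc := LinearMap.ext T.twComul_coassoc
  rTensor_counit_comp_comul := LinearMap.ext T.twComul_counit_left
  lTensor_counit_comp_comul := LinearMap.ext T.twComul_counit_right
  counit_one := counit_one
  mul_compr₂_counit := mul_compr₂_counit
  comul_one := by simp [twComul_apply]
  mul_compr₂_comul := by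
    refine LinearMap.ext₂ fun a b => ?_
    change T.twComul (a * b) = T.twComul a * T.twComul b
    simp [twComul_apply, mul_assoc]
  antipode := T.twAntipode
  mul_antipode_rTensor_comul := LinearMap.ext T.twAntipode_left
  mul_antipode_lTensor_comul := LinearMap.ext T.twAntipode_right

/-- The twisted Hopf algebra `H^J`, as a copy of `H`. -/
@[nolint unusedArguments]
def Twisted (_T : HopfTwist k H) : Type _ := H

instance : Ring T.Twisted := inferInstanceAs (Ring H)

instance : HopfAlgebra k T.Twisted := T.hopfAlgebra

/-- The identity map `H^J → H`, an isomorphism of algebras. -/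
def ofTwisted : T.Twisted ≃ₐ[k] H where
  toEquiv := Equiv.refl H
  map_mul' _ _ := rfl
  map_add' _ _ := rfl
  commutes' _ := rfl

/-- A linear functional on `H`, viewed as a linear functional on `H^J`. -/
def dualTwisted (phi : Module.Dual k H) : Module.Dual k T.Twisted :=
  phi ∘ₗ T.ofTwisted.toLinearMap

lemma comul_twisted (h : T.Twisted) :
    comul (R := k) h = TensorProduct.map T.ofTwisted.symm.toLinearMap T.ofTwisted.symm.toLinearMap
      ((T.J⁻¹).val * comul (R := k) (T.ofTwisted h) * T.J.val) := by
  rw [← twComul_apply]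
  exact (congrFun (congrArg DFunLike.coe (TensorProduct.map_id (R := k) (M := H) (N := H)))
    (T.twComul h)).symm

end HopfTwist

end

/-! Write `Q`, `u` for Q_J, u_J. Three facts give the left-hand statement. First, invariance of λ
yields S(x₍₁₎)⟨λ, x₍₂₎h⟩ = h₍₁₎⟨λ, xh₍₂₎⟩ (`slice_rTensor_antipode_comul_mul`). Second,
unimodularity makes S² the Nakayama automorphism of λ: λ(xy) = λ(y S²(x))
(`IsLeftIntegralOn.apply_mul_comm`). Third, `u` is group-like up to the twist: J⁻¹ Δ(u) (S² ⊗ S²)(J)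
= u ⊗ u (`J_inv_mul_comul_u`).

Apply S to J⁻⁽¹⁾x₍₁₎J⁽¹⁾ ⟨λ, J⁻⁽²⁾x₍₂₎J⁽²⁾u⟩. The Nakayama property carries J⁻⁽²⁾ to the far right
as S²(J⁻⁽²⁾), and invariance then replaces Δ(x) by 1 ⊗ x. What remains is (id ⊗ λ)((1 ⊗ x)W) with W
= (S(J⁽¹⁾) ⊗ 1) Δ(J⁽²⁾ u S²(J⁻⁽²⁾)) (S(J⁻⁽¹⁾) ⊗ 1). The twist equation and the third fact give W =
(Q ⊗ 1)(u ⊗ u)(S(Q⁻¹) ⊗ 1) = 1 ⊗ u, since Qu = S(Q). The result is λ(xu)1, and S is injective.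

For a right integral ρ, the functional ρ ∘ S is a left integral and ρ_J ∘ S^J = (ρ ∘ S)_J, so the
first case transfers back along the surjective S^J. -/

noncomputable section

namespace HopfTwist

/-! ### Antipode calculus in H ⊗ H and H ⊗ H ⊗ H. -/

section Antipode

variable {k H : Type*} [CommRing k] [Ring H] [HopfAlgebra k H]

local notation "S" => HopfAlgebra.antipode k (A := H)

/-- `a ⊗ b ↦ (S(a) ⊗ 1) Δ(b)` -/
def antipodeMulComul (k H : Type*) [CommRing k] [Ring H] [HopfAlgebra k H] :
    H ⊗[k] H →ₗ[k] H ⊗[k] H :=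
  LinearMap.mul' k (H ⊗[k] H) ∘ₗ TensorProduct.map
    ((TensorProduct.mk k H H).flip 1 ∘ₗ HopfAlgebra.antipode k) comul

/-- `a ⊗ b ↦ S(b) ⊗ S(a)` -/
def antipodeSwap (k H : Type*) [CommRing k] [Ring H] [HopfAlgebra k H] :
    H ⊗[k] H →ₗ[k] H ⊗[k] H :=
  TensorProduct.map (HopfAlgebra.antipode k) (HopfAlgebra.antipode k) ∘ₗ
    (TensorProduct.comm k H H).toLinearMap

/-- `a ⊗ b ↦ (S(a₍₂₎) ⊗ S(a₍₁₎)) (b ⊗ 1)` -/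
def swapComulMul (k H : Type*) [CommRing k] [Ring H] [HopfAlgebra k H] :
    H ⊗[k] H →ₗ[k] H ⊗[k] H :=
  LinearMap.mul' k (H ⊗[k] H) ∘ₗ TensorProduct.map
    (antipodeSwap k H ∘ₗ comul) ((TensorProduct.mk k H H).flip 1)

@[simp] lemma antipodeMulComul_tmul (a b : H) :
    antipodeMulComul k H (a ⊗ₜ b) = (S a ⊗ₜ[k] (1 : H)) * comul (R := k) b := by
  simp [antipodeMulComul]

@[simp] lemma antipodeSwap_tmul (a b : H) :
    antipodeSwap k H (a ⊗ₜ b) = S b ⊗ₜ S a := by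
  simp [antipodeSwap]

@[simp] lemma swapComulMul_tmul (a b : H) :
    swapComulMul k H (a ⊗ₜ b) = antipodeSwap k H (comul (R := k) a) * (b ⊗ₜ[k] (1 : H)) := by
  simp [swapComulMul]

lemma antipodeSwap_mul (x y : H ⊗[k] H) :
    antipodeSwap k H (x * y) = antipodeSwap k H y * antipodeSwap k H x := by
  induction x with
  | zero => simp
  | add x x' hx hx' => simp only [add_mul, mul_add, map_add, hx, hx']
  | tmul a b =>
    induction y with
    | zero => simp
    | add y y' hy hy' => simp only [add_mul, mul_add, map_add, hy, hy']
    | tmul c d => simp [HopfAlgebra.antipode_mul_antidistrib]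

lemma D1_comul (h : H) : D1 k H (comul (R := k) h) = D2 k H (comul (R := k) h) := by
  rw [D1_apply, D2_apply]; exact Coalgebra.coassoc_apply h

/-- `a ⊗ b ⊗ c ↦ S(a) b ⊗ c` -/
def antipodeMulLeft (k H : Type*) [CommRing k] [Ring H] [HopfAlgebra k H] :
    H ⊗[k] (H ⊗[k] H) →ₗ[k] H ⊗[k] H :=
  LinearMap.rTensor H (mSl k H) ∘ₗ (TensorProduct.assoc k H H H).symm.toLinearMap

@[simp] lemma antipodeMulLeft_tmul (a b c : H) :
    antipodeMulLeft k H (a ⊗ₜ (b ⊗ₜ c)) = (S a * b) ⊗ₜ c := by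
  simp [antipodeMulLeft]

lemma antipodeMulLeft_tmul' (a : H) (x : H ⊗[k] H) :
    antipodeMulLeft k H (a ⊗ₜ x) = (S a ⊗ₜ[k] (1 : H)) * x := by
  induction x with
  | zero => simp
  | add x y hx hy => simp only [TensorProduct.tmul_add, map_add, mul_add, hx, hy]
  | tmul b c => simp

/-- To be paired with `antipodeMulLeft_D1_mul_E1`. The two arguments agree for x = Δ(h), y = 1 by
coassociativity, and for x = y = J by the twist equation, so one pair of formulas gives an identity
in H and an identity for J. The pattern recurs for `antipodeMulSwap` and, with variations, for
`swapMul` and `sqMulAntipode`. -/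
lemma antipodeMulLeft_D2_mul_E2 (x y : H ⊗[k] H) :
    antipodeMulLeft k H (D2 k H x * E2 k H y) = antipodeMulComul k H x * y := by
  induction x with
  | zero => simp
  | add x x' hx hx' => simp only [add_mul, map_add, hx, hx']
  | tmul a b => simp [D2, E2, antipodeMulLeft_tmul', mul_assoc]

lemma antipodeMulLeft_aux (x : H ⊗[k] H) (c d q : H) :
    antipodeMulLeft k H (TensorProduct.assoc k H H H (x ⊗ₜ q) * (c ⊗ₜ (d ⊗ₜ 1))) =
      (S c * mSl k H x * d) ⊗ₜ q := by
  induction x with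
  | zero => simp
  | add x x' hx hx' => simp only [add_mul, mul_add, map_add, TensorProduct.add_tmul, hx, hx']
  | tmul a b => simp [HopfAlgebra.antipode_mul_antidistrib, mul_assoc]

lemma antipodeMulLeft_D1_mul_E1 (x y : H ⊗[k] H) :
    antipodeMulLeft k H (D1 k H x * E1 k H y) = mSl k H y ⊗ₜ eL k H x := by
  induction x with
  | zero => simp
  | add x x' hx hx' => simp only [add_mul, map_add, TensorProduct.tmul_add, hx, hx']
  | tmul p q =>
    induction y with
    | zero => simp
    | add y y' hy hy' => simp only [mul_add, map_add, TensorProduct.add_tmul, hy, hy']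
    | tmul c d =>
      have h := antipodeMulLeft_aux (comul (R := k) p) c d q
      rw [mSl_comul] at h
      refine Eq.trans ?_ (h.trans ?_)
      · rfl
      · simp [eL, Algebra.algebraMap_eq_smul_one, TensorProduct.smul_tmul]

lemma antipodeMulComul_comul (h : H) :
    antipodeMulComul k H (comul (R := k) h) = 1 ⊗ₜ h := by
  have h1 := antipodeMulLeft_D2_mul_E2 (k := k) (comul h) (1 : H ⊗[k] H)
  have h2 := antipodeMulLeft_D1_mul_E1 (k := k) (comul h) (1 : H ⊗[k] H)
  rw [D1_comul, map_one] at h2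
  rw [map_one, h2, mul_one] at h1
  rw [← h1, eL_apply]
  simp [Algebra.TensorProduct.one_def]

/-- `a ⊗ b ⊗ c ↦ S(b) c ⊗ S(a)` -/
def antipodeMulSwap (k H : Type*) [CommRing k] [Ring H] [HopfAlgebra k H] :
    H ⊗[k] (H ⊗[k] H) →ₗ[k] H ⊗[k] H :=
  (TensorProduct.comm k H H).toLinearMap ∘ₗ
    TensorProduct.map (HopfAlgebra.antipode k) (mSl k H)

@[simp] lemma antipodeMulSwap_tmul (a : H) (x : H ⊗[k] H) :
    antipodeMulSwap k H (a ⊗ₜ x) = mSl k H x ⊗ₜ S a := by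
  simp [antipodeMulSwap]

lemma mSl_comul_mul (s : H) (y : H ⊗[k] H) :
    mSl k H (comul (R := k) s * y) = counit (R := k) s • mSl k H y := by
  rw [← N_one, N_mul, N_one, mSl_comul, N_smul, Algebra.smul_def]

lemma antipodeMulSwap_D2_mul_E2 (x y : H ⊗[k] H) :
    antipodeMulSwap k H (D2 k H x * E2 k H y) = mSl k H y ⊗ₜ S (eR k H x) := by
  induction x with
  | zero => simp
  | add x x' hx hx' => simp only [add_mul, map_add, TensorProduct.tmul_add, hx, hx']
  | tmul a b => simp [D2, E2, eR, mSl_comul_mul, TensorProduct.smul_tmul]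

lemma antipodeMulSwap_aux (x : H ⊗[k] H) (c d q : H) :
    antipodeMulSwap k H (TensorProduct.assoc k H H H (x ⊗ₜ q) * (c ⊗ₜ (d ⊗ₜ 1))) =
      (S d ⊗ₜ S c) * (antipodeSwap k H x * (q ⊗ₜ[k] (1 : H))) := by
  induction x with
  | zero => simp
  | add x x' hx hx' => simp only [add_mul, mul_add, map_add, TensorProduct.add_tmul, hx, hx']
  | tmul a b => simp [HopfAlgebra.antipode_mul_antidistrib, mul_assoc]

lemma antipodeMulSwap_D1_mul_E1 (x y : H ⊗[k] H) :
    antipodeMulSwap k H (D1 k H x * E1 k H y) = antipodeSwap k H y * swapComulMul k H x := by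
  induction x with
  | zero => simp
  | add x x' hx hx' => simp only [add_mul, mul_add, map_add, hx, hx']
  | tmul p q =>
    induction y with
    | zero => simp
    | add y y' hy hy' => simp only [mul_add, add_mul, map_add, hy, hy']
    | tmul c d =>
      have h := antipodeMulSwap_aux (comul (R := k) p) c d q
      rw [antipodeSwap_tmul, swapComulMul_tmul]
      exact h

lemma swapComulMul_comul (h : H) :
    swapComulMul k H (comul (R := k) h) = 1 ⊗ₜ S h := by
  have h1 := antipodeMulSwap_D2_mul_E2 (k := k) (comul h) (1 : H ⊗[k] H)
  have h2 := antipodeMulSwap_D1_mul_E1 (k := k) (comul h) (1 : H ⊗[k] H)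
  rw [D1_comul, map_one] at h2
  rw [map_one, h2] at h1
  have h3 : antipodeSwap k H 1 = 1 := by simp [Algebra.TensorProduct.one_def]
  rw [h3, one_mul] at h1
  rw [h1, eR_apply]
  simp [Algebra.TensorProduct.one_def]

/-- `a ⊗ b ⊗ c ↦ (S(a₍₂₎) ⊗ S(a₍₁₎)) (b ⊗ c)` -/
def swapMul (k H : Type*) [CommRing k] [Ring H] [HopfAlgebra k H] :
    H ⊗[k] (H ⊗[k] H) →ₗ[k] H ⊗[k] H :=
  LinearMap.mul' k (H ⊗[k] H) ∘ₗ LinearMap.rTensor (H ⊗[k] H) (antipodeSwap k H ∘ₗ comul)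

@[simp] lemma swapMul_tmul (a : H) (x : H ⊗[k] H) :
    swapMul k H (a ⊗ₜ x) = antipodeSwap k H (comul (R := k) a) * x := by
  simp [swapMul]

lemma swapMul_aux (x : H ⊗[k] H) (c d q : H) :
    swapMul k H (TensorProduct.assoc k H H H (x ⊗ₜ q) * (c ⊗ₜ (d ⊗ₜ 1))) =
      antipodeSwap k H (comul (R := k) c) * (swapComulMul k H x * (d ⊗ₜ q)) := by
  induction x with
  | zero => simp
  | add x x' hx hx' => simp only [add_mul, mul_add, map_add, TensorProduct.add_tmul, hx, hx']
  | tmul a b => simp [antipodeSwap_mul, mul_assoc]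

lemma swapMul_D1_mul_E1 (x y : H ⊗[k] H) :
    swapMul k H (D1 k H x * E1 k H y) = swapComulMul k H y * (1 ⊗ₜ mSl k H x) := by
  induction x with
  | zero => simp
  | add x x' hx hx' => simp only [add_mul, mul_add, map_add, TensorProduct.tmul_add, hx, hx']
  | tmul p q =>
    induction y with
    | zero => simp
    | add y y' hy hy' => simp only [mul_add, add_mul, map_add, hy, hy']
    | tmul c d =>
      have h := swapMul_aux (comul (R := k) p) c d q
      rw [swapComulMul_comul] at h
      refine Eq.trans ?_ (h.trans ?_)
      · rfl
      · simp [mul_assoc]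

/-- The antipode is an anti-homomorphism of coalgebras. -/
lemma comul_antipode (h : H) :
    comul (R := k) (S h) = antipodeSwap k H (comul (R := k) h) := by
  -- Uniqueness of convolution inverses in Hom(H, H ⊗ H): the right-hand side is a left inverse of
  -- Δ, while Δ ∘ S is a right inverse.
  have hl : WithConv.toConv (antipodeSwap k H ∘ₗ comul) * WithConv.toConv (comul (R := k)) =
      (1 : WithConv (H →ₗ[k] H ⊗[k] H)) := by
    ext x
    have h1 : swapMul k H (D2 k H (comul (R := k) x) * E1 k H 1) =
        LinearMap.mul' k (H ⊗[k] H)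
          (TensorProduct.map (antipodeSwap k H ∘ₗ comul) (comul (R := k)) (comul x)) := by
      rw [map_one, mul_one, D2_apply]
      simp only [swapMul, LinearMap.comp_apply]
      rw [← LinearMap.comp_apply (LinearMap.rTensor _ _), LinearMap.rTensor_comp_lTensor]
    rw [LinearMap.convMul_apply]
    refine h1.symm.trans ?_
    rw [← D1_comul, swapMul_D1_mul_E1, mSl_comul]
    simp [Algebra.TensorProduct.one_def, Algebra.algebraMap_eq_smul_one]
  have := left_inv_eq_right_inv hl LinearMap.comul_right_inv
  exact (congrArg (fun f => f.ofConv h) this).symm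

/-- `S² ⊗ S²` -/
def antipodeSq (k H : Type*) [CommRing k] [Ring H] [HopfAlgebra k H] :
    H ⊗[k] H →ₗ[k] H ⊗[k] H :=
  antipodeSwap k H ∘ₗ antipodeSwap k H

lemma antipodeSq_mul (x y : H ⊗[k] H) :
    antipodeSq k H (x * y) = antipodeSq k H x * antipodeSq k H y := by
  simp [antipodeSq, antipodeSwap_mul]

lemma comul_antipode_antipode (h : H) :
    comul (R := k) (S (S h)) = antipodeSq k H (comul (R := k) h) := by
  simp [antipodeSq, comul_antipode]

/-- Since (S(a₍₂₎) ⊗ S(a₍₁₎))Δ(b) = Δ(S(a)b), taking x = J makes Δ(Q) appear. -/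
lemma swapMul_D2_mul_E2 (x y : H ⊗[k] H) :
    swapMul k H (D2 k H x * E2 k H y) = comul (R := k) (mSl k H x) * y := by
  induction x with
  | zero => simp
  | add x x' hx hx' => simp only [add_mul, map_add, hx, hx']
  | tmul a b => simp [D2, E2, ← comul_antipode, mul_assoc]

/-- `a ⊗ b ↦ S²(b₍₁₎) S(a) ⊗ S²(b₍₂₎)` -/
def comulMulAntipode (k H : Type*) [CommRing k] [Ring H] [HopfAlgebra k H] :
    H ⊗[k] H →ₗ[k] H ⊗[k] H :=
  LinearMap.mul' k (H ⊗[k] H) ∘ₗ (TensorProduct.comm k _ _).toLinearMap ∘ₗ TensorProduct.map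
    ((TensorProduct.mk k H H).flip 1 ∘ₗ HopfAlgebra.antipode k) (antipodeSq k H ∘ₗ comul)

@[simp] lemma comulMulAntipode_tmul (a b : H) :
    comulMulAntipode k H (a ⊗ₜ b) =
      antipodeSq k H (comul (R := k) b) * (S a ⊗ₜ[k] (1 : H)) := by
  simp [comulMulAntipode]

/-- `a ⊗ b ⊗ c ↦ S²(b) S(a) ⊗ S²(c)` -/
def sqMulAntipode (k H : Type*) [CommRing k] [Ring H] [HopfAlgebra k H] :
    H ⊗[k] (H ⊗[k] H) →ₗ[k] H ⊗[k] H :=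
  LinearMap.mul' k (H ⊗[k] H) ∘ₗ (TensorProduct.comm k _ _).toLinearMap ∘ₗ TensorProduct.map
    ((TensorProduct.mk k H H).flip 1 ∘ₗ HopfAlgebra.antipode k) (antipodeSq k H)

@[simp] lemma sqMulAntipode_tmul (a : H) (x : H ⊗[k] H) :
    sqMulAntipode k H (a ⊗ₜ x) = antipodeSq k H x * (S a ⊗ₜ[k] (1 : H)) := by
  simp [sqMulAntipode]

lemma sqMulAntipode_E2_mul_D2 (x y : H ⊗[k] H) :
    sqMulAntipode k H (E2 k H y * D2 k H x) = antipodeSq k H y * comulMulAntipode k H x := by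
  induction x with
  | zero => simp
  | add x x' hx hx' => simp only [mul_add, map_add, hx, hx']
  | tmul a b => simp [D2, E2, antipodeSq_mul, mul_assoc]

lemma sqMulAntipode_aux (x : H ⊗[k] H) (c d q : H) :
    sqMulAntipode k H ((c ⊗ₜ (d ⊗ₜ 1)) * TensorProduct.assoc k H H H (x ⊗ₜ q)) =
      (S (c * mSr k H x * S d)) ⊗ₜ S (S q) := by
  induction x with
  | zero => simp
  | add x x' hx hx' => simp only [add_mul, mul_add, map_add, TensorProduct.add_tmul, hx, hx']
  | tmul a b => simp [HopfAlgebra.antipode_mul_antidistrib, mul_assoc, antipodeSq]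

lemma sqMulAntipode_E1_mul_D1 (x y : H ⊗[k] H) :
    sqMulAntipode k H (E1 k H y * D1 k H x) = S (mSr k H y) ⊗ₜ S (S (eL k H x)) := by
  induction x with
  | zero => simp
  | add x x' hx hx' => simp only [mul_add, map_add, TensorProduct.tmul_add, hx, hx']
  | tmul p q =>
    induction y with
    | zero => simp
    | add y y' hy hy' => simp only [add_mul, map_add, TensorProduct.add_tmul, hy, hy']
    | tmul c d =>
      have h := sqMulAntipode_aux (comul (R := k) p) c d q
      rw [mSr_comul] at h
      refine Eq.trans ?_ (h.trans ?_)
      · rfl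
      · simp [eL, Algebra.algebraMap_eq_smul_one, TensorProduct.smul_tmul]

end Antipode

/-! ### Coproducts of Q and u. -/

section Twist

variable {k H : Type*} [CommRing k] [Ring H] [HopfAlgebra k H] (T : HopfTwist k H)

local notation "S" => HopfAlgebra.antipode k (A := H)

lemma antipodeMulComul_J_mul : antipodeMulComul k H T.J.val * T.J.val = T.Q.val ⊗ₜ 1 := by
  rw [← antipodeMulLeft_D2_mul_E2, ← twist_eq', antipodeMulLeft_D1_mul_E1, eL_J, Q_val]

lemma antipodeSwap_J_mul :
    antipodeSwap k H T.J.val * swapComulMul k H T.J.val = T.Q.val ⊗ₜ 1 := by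
  rw [← antipodeMulSwap_D1_mul_E1, twist_eq', antipodeMulSwap_D2_mul_E2, eR_J, Q_val,
    HopfAlgebra.antipode_one]

lemma comul_Q_mul_J :
    comul (R := k) T.Q.val * T.J.val = swapComulMul k H T.J.val * (1 ⊗ₜ T.Q.val) := by
  rw [Q_val, ← swapMul_D2_mul_E2, ← twist_eq', swapMul_D1_mul_E1]

/-- The twisted group-likeness of `Q`, assembled from two evaluations of the twist equation. -/
lemma antipodeSwap_J_mul_comul_Q_mul_J :
    antipodeSwap k H T.J.val * (comul (R := k) T.Q.val * T.J.val) = T.Q.val ⊗ₜ T.Q.val := by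
  rw [comul_Q_mul_J, ← mul_assoc, antipodeSwap_J_mul]
  simp

lemma antipodeSwap_J_mul_comul_antipode_Q :
    antipodeSwap k H T.J.val * (comul (R := k) (S T.Q.val) * antipodeSq k H T.J.val) =
      S T.Q.val ⊗ₜ S T.Q.val := by
  -- The flipped S ⊗ S reverses products and commutes with Δ up to S, so the outer factors trade
  -- places and the former first one becomes (S² ⊗ S²)(J).
  have h := congrArg (antipodeSwap k H) T.antipodeSwap_J_mul_comul_Q_mul_J
  simpa [antipodeSwap_mul, comul_antipode, mul_assoc, antipodeSq] using h

lemma Q_mul_u : T.Q.val * T.u.val = S T.Q.val := by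
  change T.Q.val * ((T.Q⁻¹).val * S T.Q.val) = _
  rw [← mul_assoc, Units.mul_inv, one_mul]

lemma antipode_Q_mul_antipode_Q_inv : S T.Q.val * S (T.Q⁻¹).val = 1 := by
  rw [← HopfAlgebra.antipode_mul_antidistrib, Units.inv_mul, HopfAlgebra.antipode_one]

/-- Comparison of the formulas for Δ(Q) and Δ(S(Q)), with S(Q) = Qu: inserting JJ⁻¹ after Δ(Q)
exposes a factor Q ⊗ Q on both sides, which cancels. -/
lemma J_inv_mul_comul_u :
    (T.J⁻¹).val * (comul (R := k) T.u.val * antipodeSq k H T.J.val) = T.u.val ⊗ₜ T.u.val := by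
  have h := T.antipodeSwap_J_mul_comul_antipode_Q
  rw [← Q_mul_u, comul_mul] at h
  have h1 : (T.Q.val ⊗ₜ[k] T.Q.val) *
      ((T.J⁻¹).val * (comul (R := k) T.u.val * antipodeSq k H T.J.val)) =
      (T.Q.val ⊗ₜ[k] T.Q.val) * (T.u.val ⊗ₜ T.u.val) := by
    rw [Algebra.TensorProduct.tmul_mul_tmul, ← h, ← antipodeSwap_J_mul_comul_Q_mul_J]
    simp only [mul_assoc]
    rw [Units.mul_inv_cancel_left]
  have h2 : ((T.Q⁻¹).val ⊗ₜ[k] (T.Q⁻¹).val) * (T.Q.val ⊗ₜ[k] T.Q.val) = 1 := by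
    simp [Algebra.TensorProduct.one_def]
  have h3 := congrArg (((T.Q⁻¹).val ⊗ₜ[k] (T.Q⁻¹).val) * ·) h1
  simpa only [← mul_assoc, h2, one_mul] using h3

lemma antipodeSq_J_inv_mul :
    antipodeSq k H (T.J⁻¹).val * comulMulAntipode k H (T.J⁻¹).val =
      S (T.Q⁻¹).val ⊗ₜ 1 := by
  rw [← sqMulAntipode_E2_mul_D2, ← twist_eq_inv, sqMulAntipode_E1_mul_D1, eL_Jinv, Q_inv_val]
  simp

lemma antipodeSq_J_mul_inv : antipodeSq k H T.J.val * antipodeSq k H (T.J⁻¹).val = 1 := by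
  rw [← antipodeSq_mul, Units.mul_inv]
  simp [antipodeSq, Algebra.TensorProduct.one_def]

lemma antipodeMulComul_J_mul_comul_u_mul :
    antipodeMulComul k H T.J.val * comul (R := k) T.u.val *
      comulMulAntipode k H (T.J⁻¹).val = 1 ⊗ₜ T.u.val := by
  -- Insert JJ⁻¹ before Δ(u) and (S² ⊗ S²)(JJ⁻¹) after it; each bracket is then known.
  calc _ = (antipodeMulComul k H T.J.val * T.J.val) *
        ((T.J⁻¹).val * (comul (R := k) T.u.val * antipodeSq k H T.J.val)) *
        (antipodeSq k H (T.J⁻¹).val * comulMulAntipode k H (T.J⁻¹).val) := by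
        simp only [mul_assoc]
        rw [Units.mul_inv_cancel_left, ← mul_assoc (antipodeSq k H _) (antipodeSq k H _),
          antipodeSq_J_mul_inv, one_mul]
    _ = _ := by
        rw [antipodeMulComul_J_mul, J_inv_mul_comul_u, antipodeSq_J_inv_mul]
        simp [Q_mul_u, antipode_Q_mul_antipode_Q_inv]

end Twist

/-! ### Invariance of integrals and the twisted left integral. -/

section Slice

variable {k H : Type*} [CommRing k] [Ring H] [HopfAlgebra k H]

local notation "S" => HopfAlgebra.antipode k (A := H)

/-- `a ⊗ b ↦ a ⟨φ, b⟩` -/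
def slice (phi : Module.Dual k H) : H ⊗[k] H →ₗ[k] H :=
  (TensorProduct.rid k H).toLinearMap ∘ₗ LinearMap.lTensor H phi

@[simp] lemma slice_tmul (phi : Module.Dual k H) (a b : H) :
    slice phi (a ⊗ₜ b) = phi b • a := by
  simp [slice]

lemma slice_comul {lam : Module.Dual k H} (hl : IsLeftIntegralOn lam) (h : H) :
    slice lam (comul (R := k) h) = lam h • (1 : H) := hl h

lemma slice_mul_mul (phi : Module.Dual k H) (p q : H) (x : H ⊗[k] H) :
    slice phi ((p ⊗ₜ[k] (1 : H)) * x * (q ⊗ₜ[k] (1 : H))) = p * slice phi x * q := by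
  induction x with
  | zero => simp
  | add x y hx hy => simp only [mul_add, add_mul, map_add, hx, hy]
  | tmul a b => simp

/-- Invariance applied to the product bh, multiplied on the left by S(a). -/
lemma slice_rTensor_antipode_mul {lam : Module.Dual k H} (hl : IsLeftIntegralOn lam)
    (x : H ⊗[k] H) (h : H) :
    slice lam (LinearMap.rTensor H S x * (1 ⊗ₜ h)) =
      slice lam (antipodeMulComul k H x * comul (R := k) h) := by
  induction x with
  | zero => simp
  | add x y hx hy => simp only [map_add, add_mul, hx, hy]
  | tmul a b =>
    have := slice_mul_mul lam (S a) 1 (comul (R := k) (b * h))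
    rw [slice_comul hl] at this
    rw [antipodeMulComul_tmul, mul_assoc, ← Bialgebra.comul_mul]
    simpa [← Algebra.TensorProduct.one_def] using this.symm

/-- `S(x₍₁₎) ⟨λ, x₍₂₎ h⟩ = h₍₁₎ ⟨λ, x h₍₂₎⟩` -/
lemma slice_rTensor_antipode_comul_mul {lam : Module.Dual k H} (hl : IsLeftIntegralOn lam)
    (x h : H) :
    slice lam (LinearMap.rTensor H S (comul (R := k) x) * (1 ⊗ₜ h)) =
      slice lam ((1 ⊗ₜ x) * comul (R := k) h) := by
  rw [slice_rTensor_antipode_mul hl, antipodeMulComul_comul]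

/-- S reverses the first leg, and `hS` moves b past the rest of the second leg to become S²(b). -/
lemma antipode_slice_mul_mul {lam : Module.Dual k H}
    (hS : ∀ x y : H, lam (x * y) = lam (y * S (S x))) (u a b c d : H) (x : H ⊗[k] H) :
    S (slice (u ⇀ₕ lam) ((a ⊗ₜ b) * x * (c ⊗ₜ d))) =
      S c * slice lam (LinearMap.rTensor H S x * (1 ⊗ₜ (d * u * S (S b)))) * S a := by
  induction x with
  | zero => simp
  | add x y hx hy => simp only [mul_add, add_mul, map_add, hx, hy]
  | tmul p q =>
    have := hS b (q * d * u)
    simp only [mul_assoc] at this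
    simp [hitLeft, HopfAlgebra.antipode_mul_antidistrib, mul_assoc, this]

lemma antipode_slice_mul_comul_mul {lam : Module.Dual k H} (hl : IsLeftIntegralOn lam)
    (hS : ∀ x y : H, lam (x * y) = lam (y * S (S x))) (u x : H) (y z : H ⊗[k] H) :
    S (slice (u ⇀ₕ lam) (y * comul (R := k) x * z)) =
      slice lam ((1 ⊗ₜ x) *
        (antipodeMulComul k H z * comul (R := k) u * comulMulAntipode k H y)) := by
  induction y with
  | zero => simp
  | add y y' hy hy' => simp only [mul_add, add_mul, map_add, hy, hy']
  | tmul a b =>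
    induction z with
    | zero => simp
    | add z z' hz hz' => simp only [mul_add, add_mul, map_add, hz, hz']
    | tmul c d =>
      rw [antipode_slice_mul_mul hS, slice_rTensor_antipode_comul_mul hl, ← slice_mul_mul]
      simp only [Bialgebra.comul_mul, comul_antipode_antipode, antipodeMulComul_tmul,
        comulMulAntipode_tmul, ← mul_assoc]
      simp

lemma isLeftIntegralOn_dualTwisted {lam : Module.Dual k H} (hl : IsLeftIntegralOn lam)
    (hS : ∀ x y : H, lam (x * y) = lam (y * S (S x))) (hinj : Function.Injective S)
    (T : HopfTwist k H) : IsLeftIntegralOn (T.dualTwisted (T.u.val ⇀ₕ lam)) := by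
  have key : ∀ x : H, slice (T.u.val ⇀ₕ lam) (T.twComul x) = lam (x * T.u.val) • (1 : H) := by
    intro x
    apply hinj
    rw [twComul_apply, antipode_slice_mul_comul_mul hl hS, antipodeMulComul_J_mul_comul_u_mul]
    simp
  exact key

/-! ### Right integrals and their passage to left integrals. -/

/-- `a ⊗ b ↦ ⟨φ, a⟩ b` -/
def sliceLeft (phi : Module.Dual k H) : H ⊗[k] H →ₗ[k] H :=
  (TensorProduct.lid k H).toLinearMap ∘ₗ LinearMap.rTensor H phi

@[simp] lemma sliceLeft_tmul (phi : Module.Dual k H) (a b : H) :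
    sliceLeft phi (a ⊗ₜ b) = phi a • b := by
  simp [sliceLeft]

lemma antipode_slice_comp_antipode (rho : Module.Dual k H) (x : H ⊗[k] H) :
    S (slice (rho ∘ₗ S) x) = sliceLeft rho (antipodeSwap k H x) := by
  induction x with
  | zero => simp
  | add x y hx hy => simp only [map_add, hx, hy]
  | tmul a b => simp

lemma _root_.IsRightIntegralOn.comp_antipode {rho : Module.Dual k H} (hr : IsRightIntegralOn rho)
    (hinj : Function.Injective S) : IsLeftIntegralOn (rho ∘ₗ S) := by
  intro h
  apply hinj
  have := antipode_slice_comp_antipode rho (comul (R := k) h)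
  rw [← comul_antipode] at this
  refine this.trans ((hr (S h)).trans ?_)
  simp

/-- S reverses the coproduct, so invariance of ρ ∘ S at g is invariance of ρ at S(g). In the main
theorem this is applied to H^J. -/
lemma isRightIntegralOn_of_comp_antipode {rho : Module.Dual k H}
    (hsurj : Function.Surjective S) (hl : IsLeftIntegralOn (rho ∘ₗ S)) :
    IsRightIntegralOn rho := by
  intro h
  obtain ⟨g, rfl⟩ := hsurj h
  have := antipode_slice_comp_antipode rho (comul (R := k) g)
  rw [← comul_antipode] at this
  refine this.symm.trans ((congrArg S (hl g)).trans ?_)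
  simp

/-- `a ⊗ b ↦ Δ(a) (1 ⊗ S(b))` sends `Δ(h)` to `h ⊗ 1`. -/
lemma comul_mul_antipode_comul (h : H) :
    LinearMap.mul' k (H ⊗[k] H) (TensorProduct.map comul (TensorProduct.mk k H H 1 ∘ₗ S)
      (comul (R := k) h)) = h ⊗ₜ 1 := by
  have h1 : ∀ x : H ⊗[k] H, LinearMap.mul' k (H ⊗[k] H)
      (TensorProduct.map comul (TensorProduct.mk k H H 1 ∘ₗ S) x) =
      LinearMap.lTensor H (mSr k H) (D1 k H x) := by
    intro x
    induction x with
    | zero => simp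
    | add x y hx hy => simp only [map_add, hx, hy]
    | tmul a b =>
      rw [D1_apply, LinearMap.rTensor_tmul]
      generalize hw : comul (R := k) a = w
      rw [TensorProduct.map_tmul, hw]
      clear hw
      induction w with
      | zero => simp
      | add w w' hw hw' =>
        rw [LinearMap.mul'_apply] at hw hw' ⊢
        simp only [add_mul, TensorProduct.add_tmul, map_add, hw, hw']
      | tmul c d => simp
  rw [h1, D1_comul, D2_apply, ← LinearMap.comp_apply, ← LinearMap.lTensor_comp]
  have h2 : mSr k H ∘ₗ comul = Algebra.linearMap k H ∘ₗ counit := LinearMap.ext mSr_comul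
  rw [h2, LinearMap.lTensor_comp, LinearMap.comp_apply, Coalgebra.lTensor_counit_comul]
  simp

/-- `⟨ρ, h g₍₁₎⟩ S(g₍₂₎) = ⟨ρ, h₍₁₎ g⟩ h₍₂₎` -/
lemma sliceLeft_mul_lTensor_antipode {rho : Module.Dual k H} (hr : IsRightIntegralOn rho)
    (h g : H) :
    sliceLeft rho ((h ⊗ₜ 1) * LinearMap.lTensor H S (comul (R := k) g)) =
      sliceLeft rho (comul (R := k) h * (g ⊗ₜ 1)) := by
  -- Writing g ⊗ 1 as Δ(g₍₁₎)(1 ⊗ S(g₍₂₎)) produces Δ(hg₍₁₎), to which invariance applies.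
  rw [← comul_mul_antipode_comul g]
  generalize comul (R := k) g = x
  induction x with
  | zero => simp
  | add x y hx hy => simp only [map_add, mul_add, hx, hy]
  | tmul a b =>
    have h1 : ∀ w : H ⊗[k] H, sliceLeft rho (w * (1 ⊗ₜ S b)) = sliceLeft rho w * S b := by
      intro w
      induction w with
      | zero => simp
      | add w w' hw hw' => simp only [map_add, add_mul, hw, hw']
      | tmul c d => simp
    have h2 : sliceLeft rho (comul (R := k) (h * a)) = rho (h * a) • (1 : H) := hr (h * a)
    have h3 := h1 (comul (R := k) (h * a))
    rw [h2, Bialgebra.comul_mul, mul_assoc] at h3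
    simpa using h3.symm

end Slice

/-! ### Nondegeneracy of integrals, bijectivity of S, Nakayama automorphism. -/

section FiniteDimensional

variable {k H : Type*} [Field k] [Ring H] [HopfAlgebra k H]

local notation "S" => HopfAlgebra.antipode k (A := H)

/-- Let K be the set of x with λ(Hx) = 0. Then Δ(K) ⊆ H ⊗ K, because g₍₁₎-slices satisfy x₍₁₎⟨λ,
gx₍₂₎⟩ = S(g₍₁₎)⟨λ, g₍₂₎x⟩ = 0. Also ε vanishes on K, since ε(x)λ(g) = λ(g S(x₍₁₎)x₍₂₎) = 0 and λ ≠
0. Hence x = x₍₁₎ε(x₍₂₎) = 0. -/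
lemma _root_.IsLeftIntegralOn.eq_zero_of_forall_mul {lam : Module.Dual k H}
    (hl : IsLeftIntegralOn lam) (h0 : lam ≠ 0) {x : H} (hx : ∀ g, lam (g * x) = 0) : x = 0 := by
  let b := Module.Basis.ofVectorSpace k H
  have expand : ∀ x : H, (∀ g, lam (g * x) = 0) →
      ∃ c : Module.Basis.ofVectorSpaceIndex k H →₀ H,
        (c.sum fun i m => b i ⊗ₜ[k] m) = comul (R := k) x ∧ ∀ i g, lam (g * c i) = 0 := by
    intro x hx
    obtain ⟨c, hc⟩ := TensorProduct.eq_repr_basis_left b (comul (R := k) x)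
    refine ⟨c, hc, fun i g => ?_⟩
    have h1 : slice lam ((1 ⊗ₜ g) * comul (R := k) x) = 0 := by
      rw [← slice_rTensor_antipode_comul_mul hl]
      generalize comul (R := k) g = w
      induction w with
      | zero => simp
      | add w w' hw hw' => simp only [map_add, add_mul, hw, hw', add_zero]
      | tmul p q => simp [hx]
    rw [← hc, Finsupp.sum, Finset.mul_sum, map_sum] at h1
    simp only [Algebra.TensorProduct.tmul_mul_tmul, one_mul, slice_tmul] at h1
    by_cases hi : i ∈ c.support
    · exact linearIndependent_iff'.1 b.linearIndependent _ _ h1 i hi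
    · simp [Finsupp.notMem_support_iff.1 hi]
  have counit_zero : ∀ x : H, (∀ g, lam (g * x) = 0) → counit (R := k) x = 0 := by
    intro x hx
    obtain ⟨c, hc, hc'⟩ := expand x hx
    have h1 := mSl_comul (k := k) x
    rw [← hc, Finsupp.sum, map_sum] at h1
    by_contra hne
    refine h0 (LinearMap.ext fun g => ?_)
    have h2 := congrArg (fun y => lam (g * y)) h1
    simp only [mSl_tmul, Finset.mul_sum, map_sum, ← mul_assoc, hc', Finset.sum_const_zero,
      Algebra.algebraMap_eq_smul_one, mul_smul_comm, mul_one, map_smul, smul_eq_mul] at h2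
    simpa [hne] using h2.symm
  obtain ⟨c, hc, hc'⟩ := expand x hx
  have h1 := congrArg (TensorProduct.rid k H) (Coalgebra.lTensor_counit_comul (R := k) x)
  rw [← hc, Finsupp.sum, map_sum, map_sum] at h1
  simpa [counit_zero _ (hc' _)] using h1.symm

/-- Mirror argument: the set K of x with ρ(xH) = 0 satisfies Δ(K) ⊆ K ⊗ H, and ε vanishes on it by
x₍₁₎S(x₍₂₎) = ε(x)1. -/
lemma _root_.IsRightIntegralOn.eq_zero_of_forall_mul {rho : Module.Dual k H}
    (hr : IsRightIntegralOn rho) (h0 : rho ≠ 0) {x : H} (hx : ∀ g, rho (x * g) = 0) : x = 0 := by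
  let b := Module.Basis.ofVectorSpace k H
  have expand : ∀ x : H, (∀ g, rho (x * g) = 0) →
      ∃ c : Module.Basis.ofVectorSpaceIndex k H →₀ H,
        (c.sum fun i m => m ⊗ₜ[k] b i) = comul (R := k) x ∧ ∀ i g, rho (c i * g) = 0 := by
    intro x hx
    obtain ⟨c, hc⟩ := TensorProduct.eq_repr_basis_right b (comul (R := k) x)
    refine ⟨c, hc, fun i g => ?_⟩
    have h1 : sliceLeft rho (comul (R := k) x * (g ⊗ₜ 1)) = 0 := by
      rw [← sliceLeft_mul_lTensor_antipode hr]
      generalize comul (R := k) g = w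
      induction w with
      | zero => simp
      | add w w' hw hw' => simp only [map_add, mul_add, hw, hw', add_zero]
      | tmul p q => simp [hx]
    rw [← hc, Finsupp.sum, Finset.sum_mul, map_sum] at h1
    simp only [Algebra.TensorProduct.tmul_mul_tmul, mul_one, sliceLeft_tmul] at h1
    by_cases hi : i ∈ c.support
    · exact linearIndependent_iff'.1 b.linearIndependent _ _ h1 i hi
    · simp [Finsupp.notMem_support_iff.1 hi]
  have counit_zero : ∀ x : H, (∀ g, rho (x * g) = 0) → counit (R := k) x = 0 := by
    intro x hx
    obtain ⟨c, hc, hc'⟩ := expand x hx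
    have h1 := mSr_comul (k := k) x
    rw [← hc, Finsupp.sum, map_sum] at h1
    by_contra hne
    refine h0 (LinearMap.ext fun g => ?_)
    have h2 := congrArg (fun y => rho (y * g)) h1
    simp only [mSr_tmul, Finset.sum_mul, map_sum, mul_assoc, hc', Finset.sum_const_zero,
      Algebra.algebraMap_eq_smul_one, smul_mul_assoc, one_mul, map_smul, smul_eq_mul] at h2
    simpa [hne] using h2.symm
  obtain ⟨c, hc, hc'⟩ := expand x hx
  have h1 := congrArg (TensorProduct.lid k H) (Coalgebra.rTensor_counit_comul (R := k) x)
  rw [← hc, Finsupp.sum, map_sum, map_sum] at h1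
  simpa [counit_zero _ (hc' _)] using h1.symm

/-- S(L₍₁₎) and L₍₂₎ are dual bases for the form (a, b) ↦ λ(ab): invariance turns the slice into
h₍₁₎⟨λ, Lh₍₂₎⟩ = h₍₁₎ε(h₍₂₎). -/
lemma _root_.IsLeftIntegralOn.slice_antipode_integral {lam : Module.Dual k H}
    (hl : IsLeftIntegralOn lam) {L : H} (h1 : lam L = 1)
    (hL : ∀ h, L * h = counit (R := k) h • L) (h : H) :
    slice lam (LinearMap.rTensor H S (comul (R := k) L) * (1 ⊗ₜ h)) = h := by
  rw [slice_rTensor_antipode_comul_mul hl]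
  have h2 : ∀ w : H ⊗[k] H, slice lam ((1 ⊗ₜ L) * w) = eR k H w := by
    intro w
    induction w with
    | zero => simp
    | add w w' hw hw' => simp only [map_add, mul_add, hw, hw']
    | tmul p q => simp [hL, h1, eR]
  rw [h2, eR_apply]
  simp

lemma _root_.IsLeftIntegralOn.slice_mul_comul_integral {lam : Module.Dual k H}
    (hl : IsLeftIntegralOn lam) {L : H} (h1 : lam L = 1)
    (hL : ∀ h, h * L = counit (R := k) h • L) (h : H) :
    slice lam ((1 ⊗ₜ h) * comul (R := k) L) = S h := by
  rw [← slice_rTensor_antipode_comul_mul hl]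
  have h2 : ∀ w : H ⊗[k] H,
      slice lam (LinearMap.rTensor H S w * (1 ⊗ₜ L)) = S (eR k H w) := by
    intro w
    induction w with
    | zero => simp
    | add w w' hw hw' => simp only [map_add, add_mul, hw, hw']
    | tmul p q => simp [hL, h1, eR]
  rw [h2, eR_apply]
  simp

variable [FiniteDimensional k H]

lemma _root_.IsLeftIntegralOn.exists_mul_right {lam : Module.Dual k H}
    (hl : IsLeftIntegralOn lam) (h0 : lam ≠ 0) (phi : Module.Dual k H) :
    ∃ y, ∀ x, lam (x * y) = phi x := by
  let f : H →ₗ[k] Module.Dual k H := (LinearMap.mul k H).flip.compr₂ lam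
  have hf : Function.Injective f := (injective_iff_map_eq_zero f).2 fun x hx =>
    hl.eq_zero_of_forall_mul h0 fun g => LinearMap.congr_fun hx g
  obtain ⟨y, hy⟩ := (LinearMap.injective_iff_surjective_of_finrank_eq_finrank
    (Subspace.dual_finrank_eq (K := k) (V := H)).symm).1 hf phi
  exact ⟨y, fun x => LinearMap.congr_fun hy x⟩

lemma _root_.IsRightIntegralOn.exists_mul_left {rho : Module.Dual k H}
    (hr : IsRightIntegralOn rho) (h0 : rho ≠ 0) (phi : Module.Dual k H) :
    ∃ y, ∀ x, rho (y * x) = phi x := by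
  let f : H →ₗ[k] Module.Dual k H := (LinearMap.mul k H).compr₂ rho
  have hf : Function.Injective f := (injective_iff_map_eq_zero f).2 fun x hx =>
    hr.eq_zero_of_forall_mul h0 fun g => LinearMap.congr_fun hx g
  obtain ⟨y, hy⟩ := (LinearMap.injective_iff_surjective_of_finrank_eq_finrank
    (Subspace.dual_finrank_eq (K := k) (V := H)).symm).1 hf phi
  exact ⟨y, fun x => LinearMap.congr_fun hy x⟩

/-- A two-sided integral in `H` on which a given non-zero left integral on `H` takes the value
`1`. -/
lemma _root_.IsLeftIntegralOn.exists_integral (hH : IsUnimodular k H) {lam : Module.Dual k H}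
    (hl : IsLeftIntegralOn lam) (h0 : lam ≠ 0) :
    ∃ L : H, lam L = 1 ∧ (∀ h, h * L = counit (R := k) h • L) ∧
      ∀ h, L * h = counit (R := k) h • L := by
  -- L represents ε through λ; then λ(ghL) = ε(g)ε(h), and nondegeneracy makes L a left integral.
  obtain ⟨L, hL⟩ := hl.exists_mul_right h0 counit
  have hleft : ∀ h, h * L = counit (R := k) h • L := fun h => sub_eq_zero.1 <|
    hl.eq_zero_of_forall_mul h0 fun g => by
      rw [mul_sub, map_sub, ← mul_assoc, hL, mul_smul_comm, map_smul, hL]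
      simp [mul_comm]
  exact ⟨L, by simpa using hL 1, hleft, (hH L).1 hleft⟩

/-- A left integral in `H` on which a given non-zero right integral on `H` takes the value
`1`. -/
lemma _root_.IsRightIntegralOn.exists_integral (hH : IsUnimodular k H) {rho : Module.Dual k H}
    (hr : IsRightIntegralOn rho) (h0 : rho ≠ 0) :
    ∃ L : H, rho L = 1 ∧ ∀ h, h * L = counit (R := k) h • L := by
  obtain ⟨L, hL⟩ := hr.exists_mul_left h0 counit
  have hright : ∀ h, L * h = counit (R := k) h • L := fun h => sub_eq_zero.1 <|
    hr.eq_zero_of_forall_mul h0 fun g => by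
      rw [sub_mul, map_sub, mul_assoc, hL, smul_mul_assoc, map_smul, hL]
      simp
  exact ⟨L, by simpa using hL 1, (hH L).2 hright⟩

lemma _root_.IsRightIntegralOn.antipode_bijective (hH : IsUnimodular k H) {rho : Module.Dual k H}
    (hr : IsRightIntegralOn rho) (h0 : rho ≠ 0) : Function.Bijective S := by
  obtain ⟨L, h1, hL⟩ := hr.exists_integral hH h0
  suffices hs : Function.Surjective S from ⟨LinearMap.injective_iff_surjective.2 hs, hs⟩
  intro h
  have h2 : ∀ w : H ⊗[k] H, sliceLeft rho (w * (L ⊗ₜ 1)) = eL k H w := by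
    intro w
    induction w with
    | zero => simp
    | add w w' hw hw' => simp only [map_add, add_mul, hw, hw']
    | tmul p q => simp [hL, h1, eL]
  have h3 := sliceLeft_mul_lTensor_antipode hr h L
  rw [h2, eL_apply, Coalgebra.rTensor_counit_comul, TensorProduct.lid_tmul, one_smul] at h3
  rw [← h3]
  generalize comul (R := k) L = w
  induction w with
  | zero => exact ⟨0, by simp⟩
  | add w w' hw hw' =>
    obtain ⟨a, ha⟩ := hw
    obtain ⟨c, hc⟩ := hw'
    exact ⟨a + c, by simp only [map_add, mul_add, ha, hc]⟩
  | tmul p q => exact ⟨rho (h * p) • q, by simp⟩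

/-- The expansion h = S(L₍₁₎)⟨λ, L₍₂₎h⟩ places every h in the range of S; finite dimension does the
rest. -/
lemma _root_.IsLeftIntegralOn.antipode_bijective (hH : IsUnimodular k H) {lam : Module.Dual k H}
    (hl : IsLeftIntegralOn lam) (h0 : lam ≠ 0) : Function.Bijective S := by
  obtain ⟨L, h1, -, hL⟩ := hl.exists_integral hH h0
  suffices hs : Function.Surjective S from ⟨LinearMap.injective_iff_surjective.2 hs, hs⟩
  intro h
  rw [← hl.slice_antipode_integral h1 hL h]
  generalize comul (R := k) L = w
  induction w with
  | zero => exact ⟨0, by simp⟩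
  | add w w' hw hw' =>
    obtain ⟨a, ha⟩ := hw
    obtain ⟨c, hc⟩ := hw'
    exact ⟨a + c, by simp only [map_add, add_mul, ha, hc]⟩
  | tmul p q => exact ⟨lam (q * h) • p, by simp⟩

/-- The Nakayama automorphism of a left integral on a unimodular Hopf algebra is `S²`. -/
lemma _root_.IsLeftIntegralOn.apply_mul_comm (hH : IsUnimodular k H) {lam : Module.Dual k H}
    (hl : IsLeftIntegralOn lam) (h0 : lam ≠ 0) (x y : H) :
    lam (x * y) = lam (y * S (S x)) := by
  obtain ⟨L, h1, hL, hL'⟩ := hl.exists_integral hH h0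
  have hsum := (ℛ k L).eq
  -- The other dual basis expansion, y = ⟨λ, y S(L₍₁₎)⟩L₍₂₎, checked against functionals, all of
  -- which have the form λ(· h).
  have hr : ∀ y : H, ∑ i ∈ (ℛ k L).index,
      lam (y * S ((ℛ k L).left i)) • (ℛ k L).right i = y := by
    intro y
    refine (Module.forall_dual_apply_eq_zero_iff k _).1 (fun phi => ?_) |> sub_eq_zero.1
    obtain ⟨h, hh⟩ : ∃ h, ∀ x, lam (x * h) = phi x := hl.exists_mul_right h0 phi
    rw [← hh, sub_mul, map_sub, sub_eq_zero]
    conv_rhs => rw [← hl.slice_antipode_integral h1 hL' h, ← hsum]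
    simp [Finset.sum_mul, Finset.mul_sum, mul_comm]
  -- With S(x) = L₍₁₎⟨λ, xL₍₂₎⟩, both sides become the sum of λ(y S(L₍₁₎)) λ(xL₍₂₎).
  conv_rhs => rw [← hl.slice_mul_comul_integral h1 hL x, ← hsum]
  conv_lhs => rw [← hr y]
  simp [Finset.mul_sum, mul_comm]

end FiniteDimensional

/-! ### Nonvanishing, and the twisted antipode on right integrals. -/

lemma dualTwisted_ne_zero {k H : Type*} [CommRing k] [Ring H] [HopfAlgebra k H]
    (T : HopfTwist k H) {phi : Module.Dual k H} (h : phi ≠ 0) : T.dualTwisted phi ≠ 0 :=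
  fun h' => h (LinearMap.ext fun x => LinearMap.congr_fun h' (T.ofTwisted.symm x))

lemma hitLeft_units_ne_zero {k H : Type*} [CommRing k] [Ring H] [Algebra k H]
    (u : Hˣ) {phi : Module.Dual k H} (h : phi ≠ 0) : u.val ⇀ₕ phi ≠ 0 :=
  fun h' => h (LinearMap.ext fun x => by
    simpa [hitLeft] using LinearMap.congr_fun h' (x * (u⁻¹).val))

lemma hitRight_units_ne_zero {k H : Type*} [CommRing k] [Ring H] [Algebra k H]
    (u : Hˣ) {phi : Module.Dual k H} (h : phi ≠ 0) : phi ↼ₕ u.val ≠ 0 :=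
  fun h' => h (LinearMap.ext fun x => by
    simpa [hitRight] using LinearMap.congr_fun h' ((u⁻¹).val * x))

lemma twAntipode_surjective {k H : Type*} [CommRing k] [Ring H] [HopfAlgebra k H]
    (T : HopfTwist k H) (hs : Function.Surjective (HopfAlgebra.antipode k (A := H))) :
    Function.Surjective T.twAntipode := by
  intro y
  obtain ⟨x, hx⟩ := hs (T.Q.val * y * (T.Q⁻¹).val)
  exact ⟨x, by rw [twAntipode_apply, hx]; simp [mul_assoc]⟩

/-- `ρ_J ∘ S^J = (ρ ∘ S)_J` -/
lemma dualTwisted_hitRight_comp_antipode {k H : Type*} [CommRing k] [Ring H] [HopfAlgebra k H]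
    (T : HopfTwist k H) {rho : Module.Dual k H}
    (hS : ∀ x y : H, rho (HopfAlgebra.antipode k (x * y)) =
      rho (HopfAlgebra.antipode k (y * HopfAlgebra.antipode k (HopfAlgebra.antipode k x))))
    (hs : Function.Surjective (HopfAlgebra.antipode k (A := H))) :
    T.dualTwisted (rho ↼ₕ (T.u⁻¹).val) ∘ₗ HopfAlgebra.antipode k (A := T.Twisted) =
      T.dualTwisted (T.u.val ⇀ₕ (rho ∘ₗ HopfAlgebra.antipode k)) := by
  -- The Nakayama property of ρ ∘ S, read for ρ. It brings Q in ρ(S(Q⁻¹)S(x)Q) to the front as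
  -- S²(Q), and S²(Q)S(Q⁻¹)S(x) = S(xu).
  have hrho : ∀ a b : H,
      rho (a * b) = rho (HopfAlgebra.antipode k (HopfAlgebra.antipode k b) * a) := by
    intro a b
    obtain ⟨y, rfl⟩ := hs a
    obtain ⟨x, rfl⟩ := hs b
    rw [← HopfAlgebra.antipode_mul_antidistrib, ← HopfAlgebra.antipode_mul_antidistrib, hS]
  have hu : (T.u⁻¹).val * (T.Q⁻¹).val = HopfAlgebra.antipode k (T.Q⁻¹).val := by
    change HopfAlgebra.antipode k (T.Q⁻¹).val * T.Q.val * (T.Q⁻¹).val = _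
    rw [mul_assoc, Units.mul_inv, mul_one]
  have key : ∀ x : H, rho ((T.u⁻¹).val * T.twAntipode x) =
      rho (HopfAlgebra.antipode k (x * T.u.val)) := by
    intro x
    rw [twAntipode_apply, ← mul_assoc, ← mul_assoc, hu, hrho, ← mul_assoc,
      ← HopfAlgebra.antipode_mul_antidistrib, ← HopfAlgebra.antipode_mul_antidistrib]
    rfl
  exact LinearMap.ext key

end HopfTwist

end

theorem mainTheorem4 {k H : Type*} [Field k] [IsAlgClosed k] [Ring H] [HopfAlgebra k H]
    [FiniteDimensional k H] (hH : IsUnimodular k H) (T : HopfTwist k H) :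
    (∀ lam : Module.Dual k H, IsLeftIntegralOn lam → lam ≠ 0 →
      IsLeftIntegralOn (T.dualTwisted (T.u.val ⇀ₕ lam)) ∧
        T.dualTwisted (T.u.val ⇀ₕ lam) ≠ 0) ∧
    (∀ rho : Module.Dual k H, IsRightIntegralOn rho → rho ≠ 0 →
      IsRightIntegralOn (T.dualTwisted (rho ↼ₕ (T.u⁻¹).val)) ∧
        T.dualTwisted (rho ↼ₕ (T.u⁻¹).val) ≠ 0) := by
  refine ⟨fun lam hl h0 => ⟨?_, ?_⟩, fun rho hr h0 => ⟨?_, ?_⟩⟩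
  · exact HopfTwist.isLeftIntegralOn_dualTwisted hl (hl.apply_mul_comm hH h0)
      (hl.antipode_bijective hH h0).1 T
  · exact T.dualTwisted_ne_zero (HopfTwist.hitLeft_units_ne_zero _ h0)
  · have hS := hr.antipode_bijective hH h0
    have hl := hr.comp_antipode hS.1
    have hl0 : rho ∘ₗ HopfAlgebra.antipode k ≠ 0 := fun h => h0 <| LinearMap.ext fun x => by
      obtain ⟨y, rfl⟩ := hS.2 x
      exact LinearMap.congr_fun h y
    have hN := hl.apply_mul_comm hH hl0
    refine HopfTwist.isRightIntegralOn_of_comp_antipode (T.twAntipode_surjective hS.2) ?_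
    rw [T.dualTwisted_hitRight_comp_antipode hN hS.2]
    exact HopfTwist.isLeftIntegralOn_dualTwisted hl hN hS.1 T
  · exact T.dualTwisted_ne_zero (HopfTwist.hitRight_units_ne_zero _ h0)
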